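/- Let $m\ge 1$ be an integer and $\lambda>0$. For an integer $k\ge1$ and $w\ge 0$ let $\Gamma(k,w)=\int_w^\infty t^{k-1}e^{-t}\,dt$ and let $g(m,w)=\Gamma(m+1,w)-(m+1)\Gamma(m,w)$. A single additive buyer has values $x=(x_1,\dots,x_m)\in\mathbb R_+^m$ for $m$ goods, drawn i.i.d. from the exponential distribution with parameter $\lambda$; write $F$ for their joint law. A (possibly randomized) mechanism is a pair of functions $a:\mathbb R_+^m\to[0,1]^m$ (allocation probabilities) and $p:\mathbb R_+^m\to\mathbb R_+$ (payment). It is truthful if $a(x)\cdot x-p(x)\ge a(x')\cdot x-p(x')$ for all $x,x'\in\mathbb R_+^m$, and individually rational if $a(x)\cdot x-p(x)\ge 0$ for all $x\in\mathbb R_+^m$. Its revenue is $\mathbb E_{x\sim F}[p(x)]$. Full bundling at price $q\ge0$ is the deterministic mechanism that sells all goods for a total payment of $q$ if $\sum_j x_j\ge q$, and otherwise sells nothing and charges nothing. **Theorem.** The function $g(m,\cdot)$ has a unique root $\gamma^*_m$ in $[0,\infty)$, and $\gamma^*_m>0$. The payment function of every truthful, individually rational mechanism is $F$-integrable, and full bundling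 at price $\gamma^*_m/\lambda$ is truthful, individually rational, and has the largest revenue among all truthful, individually rational mechanisms. Among all bundle prices $q\ge 0$, $\gamma^*_m/\lambda$ is the only one for which full bundling is optimal. Moreover, the revenue of full bundling at price $\gamma^*_m/\lambda$ equals the maximum of $$R(u;F)=\int_{\mathbb R_+^m}\bigl(\nabla u(x)\cdot x-u(x)\bigr)\,dF(x)$$ over all nonnegative convex functions $u$ on $\mathbb R_+^m$ with $0\le \partial u/\partial x_j\le 1$ almost everywhere for every $j$. -/

import Mathlib

open MeasureTheory ProbabilityTheory

noncomputable section

/-- The upper incomplete Gamma function `Γ(m, w) = ∫_w^∞ t^(m-1) e^(-t) dt`, for `m ≥ 1`. -/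
def upperGamma (m : ℕ) (w : ℝ) : ℝ :=
  ∫ t in Set.Ioi w, t ^ (m - 1) * Real.exp (-t)

/-- `g(m, w) = Γ(m+1, w) - (m+1) Γ(m, w)`. -/
def gFun (m : ℕ) (w : ℝ) : ℝ :=
  upperGamma (m + 1) w - ((m : ℝ) + 1) * upperGamma m w

/-- The space of valuation (and bid) vectors: the nonnegative orthant of `ℝ^m`. -/
def valuationSpace (m : ℕ) : Set (Fin m → ℝ) :=
  {x | ∀ j, 0 ≤ x j}

/-- The joint law of `m` independent exponential values with common parameter `l`. -/
def iidExp (m : ℕ) (l : ℝ) : Measure (Fin m → ℝ) :=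
  Measure.pi fun _ : Fin m => expMeasure l

/-- The data of a direct-revelation mechanism for `m` goods: at the bid vector `x`, good `j` is
sold with probability `alloc x j` and the buyer is charged `pay x` in total.  Only bids in
`valuationSpace m` matter. -/
structure Mechanism (m : ℕ) where
  alloc : (Fin m → ℝ) → Fin m → ℝ
  pay : (Fin m → ℝ) → ℝ

namespace Mechanism

variable {m : ℕ}

/-- Utility of an additive buyer with true values `x` who reports `x'`. -/
def utility (M : Mechanism m) (x' x : Fin m → ℝ) : ℝ :=
  ∑ j, M.alloc x' j * x j - M.pay x'

/-- Allocations are probabilities and payments are nonnegative. -/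
def IsValid (M : Mechanism m) : Prop :=
  ∀ x ∈ valuationSpace m, (∀ j, M.alloc x j ∈ Set.Icc (0 : ℝ) 1) ∧ 0 ≤ M.pay x

/-- Individual rationality. -/
def IsIR (M : Mechanism m) : Prop :=
  ∀ x ∈ valuationSpace m, 0 ≤ M.utility x x

/-- Incentive compatibility (truthfulness). -/
def IsIC (M : Mechanism m) : Prop :=
  ∀ x ∈ valuationSpace m, ∀ x' ∈ valuationSpace m, M.utility x' x ≤ M.utility x x

/-- The mechanisms over which revenue is maximized: possibly randomized, truthful and
individually rational. -/
def IsFeasible (M : Mechanism m) : Prop :=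
  M.IsValid ∧ M.IsIR ∧ M.IsIC

/-- Expected revenue when the values are drawn from `F`. -/
def revenue (M : Mechanism m) (F : Measure (Fin m → ℝ)) : ℝ :=
  ∫ x, M.pay x ∂F

/-- `M` is feasible and no feasible mechanism has larger expected revenue. -/
def IsOptimal (M : Mechanism m) (F : Measure (Fin m → ℝ)) : Prop :=
  M.IsFeasible ∧ ∀ M' : Mechanism m, M'.IsFeasible → M'.revenue F ≤ M.revenue F

open Classical in
/-- Deterministic full bundling: all goods are offered together, take it or leave it, at the
price `q`. -/
def fullBundle (m : ℕ) (q : ℝ) : Mechanism m where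
  alloc x _ := if q ≤ ∑ j, x j then 1 else 0
  pay x := if q ≤ ∑ j, x j then q else 0

end Mechanism

/-- The partial derivative of `u` in the coordinate `j`.  It is only used at almost every point
and for convex `u`, which are almost everywhere differentiable. -/
def partialD {m : ℕ} (u : (Fin m → ℝ) → ℝ) (j : Fin m) (x : Fin m → ℝ) : ℝ :=
  fderiv ℝ u x (Pi.single j 1)

/-- Nonnegative convex functions on the valuation space all of whose partial derivatives lie in
`[0, 1]` almost everywhere: the feasible utility functions. -/
def IsFeasibleUtility {m : ℕ} (u : (Fin m → ℝ) → ℝ) : Prop :=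
  ConvexOn ℝ (valuationSpace m) u ∧
  (∀ x ∈ valuationSpace m, 0 ≤ u x) ∧
  ∀ᵐ x ∂(volume.restrict (valuationSpace m)), ∀ j, partialD u j x ∈ Set.Icc (0 : ℝ) 1

/-- The revenue functional `R(u; F) = ∫ (∇u(x) · x - u(x)) dF(x)`. -/
def utilityRevenue {m : ℕ} (u : (Fin m → ℝ) → ℝ) (F : Measure (Fin m → ℝ)) : ℝ :=
  ∫ x, (∑ j, partialD u j x * x j - u x) ∂F

end

/-! Revenue is controlled by the radial derivative alone. Write `D x = ∇u(x) · x` and `s = ∑ j, x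
j`. Integrating a feasible utility along the segment from the origin gives `u x ≥ ∫₀¹ D(t x)/t dt`.
Averaging over `F`, exchanging integrals and substituting `y = t x` turns the right side into `∫ D ·
radialWeight`, where `radialWeight` is the exponential density spread back along rays. Hence `R(u;
F) ≤ ∫ D · virtualWeight`, and since the density depends only on `s`, `virtualWeight` is a positive
multiple of `g(m, l s)` off the boundary.

The constraints on the partial derivatives force `0 ≤ D ≤ s`. As `g(m, ·)` changes sign once, from
negative to positive at `γ` (`exists_gFun_sign`), the integral is maximized pointwise by `D = 0` for
`l s < γ` and `D = s` for `l s ≥ γ` (`mul_virtualWeight_le`). That `D` belongs to full bundling at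
`γ / l`, whose utility vanishes at the origin, so the bound is attained (`revenue_fullBundle`).
Another bundle price loses strictly on the slab between the two prices.

Mechanisms reduce to utilities: the truthful utility is convex, its gradient is almost everywhere
the allocation, and the payment is `D - u` (`IsFeasible.pay_ae_eq`). -/

/-! ### The incomplete Gamma function and the sign of `g`. -/

theorem integrableOn_pow_mul_exp_neg (n : ℕ) (w : ℝ) (hw : 0 ≤ w) :
    IntegrableOn (fun t : ℝ => t ^ n * Real.exp (-t)) (Set.Ioi w) := by
  have h := Real.GammaIntegral_convergent (s := (n : ℝ) + 1) (by positivity)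
  refine (h.mono_set (Set.Ioi_subset_Ioi hw)).congr_fun (fun t _ => ?_) measurableSet_Ioi
  simp [mul_comm]

theorem upperGamma_eq_sub (m : ℕ) {w : ℝ} (hw : 0 ≤ w) :
    upperGamma m w = upperGamma m 0 - ∫ t in (0 : ℝ)..w, t ^ (m - 1) * Real.exp (-t) := by
  have h := intervalIntegral.integral_Ioi_sub_Ioi
    (integrableOn_pow_mul_exp_neg (m - 1) 0 le_rfl) hw
  unfold upperGamma
  linarith

theorem upperGamma_nonneg (m : ℕ) {w : ℝ} (hw : 0 ≤ w) : 0 ≤ upperGamma m w :=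
  setIntegral_nonneg measurableSet_Ioi fun _ ht =>
    mul_nonneg (pow_nonneg (hw.trans (le_of_lt ht)) _) (Real.exp_pos _).le

theorem upperGamma_zero_pos (m : ℕ) : 0 < upperGamma m 0 := by
  unfold upperGamma
  rw [setIntegral_pos_iff_support_of_nonneg_ae]
  · have : Set.Ioi (0 : ℝ) ⊆
        (Function.support fun t : ℝ => t ^ (m - 1) * Real.exp (-t)) ∩ Set.Ioi 0 := fun t ht =>
      ⟨(mul_pos (pow_pos ht _) (Real.exp_pos _)).ne', ht⟩
    exact lt_of_lt_of_le (by simp) (measure_mono this)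
  · filter_upwards [ae_restrict_mem measurableSet_Ioi] with t ht
    exact mul_nonneg (pow_nonneg (le_of_lt ht) _) (Real.exp_pos _).le
  · exact integrableOn_pow_mul_exp_neg _ _ le_rfl

theorem tendsto_upperGamma_atTop (m : ℕ) :
    Filter.Tendsto (upperGamma m) Filter.atTop (nhds 0) := by
  have h := intervalIntegral_tendsto_integral_Ioi 0
    (integrableOn_pow_mul_exp_neg (m - 1) 0 le_rfl) Filter.tendsto_id
  have h2 := (tendsto_const_nhds (x := upperGamma m 0)).sub h
  rw [show upperGamma m 0 - ∫ t in Set.Ioi (0 : ℝ), t ^ (m - 1) * Real.exp (-t) = 0 by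
    simp [upperGamma]] at h2
  refine h2.congr' ?_
  filter_upwards [Filter.eventually_ge_atTop 0] with w hw
  rw [upperGamma_eq_sub m hw]
  rfl

/-- Integration by parts, in the form `Γ(m+1, w) = m Γ(m, w) + w^m e^(-w)`. -/
theorem upperGamma_succ (m : ℕ) {w : ℝ} (hw : 0 ≤ w) :
    upperGamma (m + 1) w = m * upperGamma m w + w ^ m * Real.exp (-w) := by
  have hd : ∀ x ∈ Set.Ici w, HasDerivAt (fun t : ℝ => -(t ^ m * Real.exp (-t)))
      (x ^ m * Real.exp (-x) - m * (x ^ (m - 1) * Real.exp (-x))) x := by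
    intro x _
    have := ((hasDerivAt_pow m x).mul (hasDerivAt_neg x).exp).neg
    refine this.congr_deriv ?_
    ring
  have hi1 := integrableOn_pow_mul_exp_neg m w hw
  have hi2 := (integrableOn_pow_mul_exp_neg (m - 1) w hw).const_mul (m : ℝ)
  have ht : Filter.Tendsto (fun t : ℝ => -(t ^ m * Real.exp (-t))) Filter.atTop (nhds 0) := by
    simpa using (Real.tendsto_pow_mul_exp_neg_atTop_nhds_zero m).neg
  have h := integral_Ioi_of_hasDerivAt_of_tendsto' hd (hi1.sub hi2) ht
  rw [integral_sub hi1 hi2, integral_const_mul] at h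
  simp only [upperGamma, Nat.add_sub_cancel]
  linarith

/-- In this form `g` is a density term minus a tail term, which is how it arises in `virtualWeight`.
-/
theorem gFun_eq (m : ℕ) {w : ℝ} (hw : 0 ≤ w) :
    gFun m w = w ^ m * Real.exp (-w) - upperGamma m w := by
  rw [gFun, upperGamma_succ m hw]
  ring

theorem continuousOn_upperGamma (m : ℕ) : ContinuousOn (upperGamma m) (Set.Ici 0) := by
  have hc : Continuous fun t : ℝ => t ^ (m - 1) * Real.exp (-t) := by fun_prop
  have := intervalIntegral.continuous_primitive (μ := volume)
    (fun a b => hc.intervalIntegrable a b) 0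
  exact (continuous_const.sub this).continuousOn.congr fun w hw => upperGamma_eq_sub m hw

theorem continuousOn_gFun (m : ℕ) : ContinuousOn (gFun m) (Set.Ici 0) :=
  (continuousOn_upperGamma (m + 1)).sub (continuousOn_const.mul (continuousOn_upperGamma m))

/-- The last factor makes `g(m, ·)` increase up to `m + 1` and decrease afterwards. -/
theorem hasDerivAt_gFun {m : ℕ} (hm : 0 < m) {w : ℝ} (hw : 0 < w) :
    HasDerivAt (gFun m) (w ^ (m - 1) * Real.exp (-w) * (m + 1 - w)) w := by
  have hc : Continuous fun t : ℝ => t ^ (m - 1) * Real.exp (-t) := by fun_prop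
  have h1 := intervalIntegral.integral_hasDerivAt_right (hc.intervalIntegrable 0 w)
    (hc.stronglyMeasurableAtFilter _ _) hc.continuousAt
  have h2 := ((hasDerivAt_pow m w).mul (hasDerivAt_neg w).exp).sub (h1.const_sub (upperGamma m 0))
  refine (h2.congr_of_eventuallyEq ?_).congr_deriv ?_
  · filter_upwards [eventually_gt_nhds hw] with x hx
    rw [gFun_eq m hx.le, upperGamma_eq_sub m hx.le]
    rfl
  · obtain ⟨k, rfl⟩ := Nat.exists_eq_succ_of_ne_zero hm.ne'
    simp
    ring

/-- The function `g(m, ·)` changes sign exactly once on `[0, ∞)`, at a positive point. -/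
theorem exists_gFun_sign {m : ℕ} (hm : 0 < m) :
    ∃ γ : ℝ, 0 < γ ∧ gFun m γ = 0 ∧ (∀ w, 0 ≤ w → w < γ → gFun m w < 0) ∧
      ∀ w, γ < w → 0 < gFun m w := by
  have hmono : StrictMonoOn (gFun m) (Set.Icc 0 (m + 1)) := by
    refine strictMonoOn_of_deriv_pos (convex_Icc _ _)
      ((continuousOn_gFun m).mono Set.Icc_subset_Ici_self) fun x hx => ?_
    rw [interior_Icc] at hx
    rw [(hasDerivAt_gFun hm hx.1).deriv]
    have := hx.1
    have := sub_pos.2 hx.2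
    positivity
  have hanti : StrictAntiOn (gFun m) (Set.Ici (m + 1)) := by
    have hpos : (0 : ℝ) < m + 1 := by positivity
    refine strictAntiOn_of_deriv_neg (convex_Ici _)
      ((continuousOn_gFun m).mono (Set.Ici_subset_Ici.2 hpos.le)) fun x hx => ?_
    rw [interior_Ici] at hx
    have hx0 : 0 < x := hpos.trans hx
    rw [(hasDerivAt_gFun hm hx0).deriv]
    exact mul_neg_of_pos_of_neg (by positivity) (sub_neg.2 hx)
  have hlim : Filter.Tendsto (gFun m) Filter.atTop (nhds 0) := by
    have := (Real.tendsto_pow_mul_exp_neg_atTop_nhds_zero m).sub (tendsto_upperGamma_atTop m)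
    rw [sub_zero] at this
    refine this.congr' ?_
    filter_upwards [Filter.eventually_ge_atTop 0] with w hw
    rw [gFun_eq m hw]
  -- Past its peak `g` decreases to the limit `0`; the comparison with `w + 1` makes the inequality
  -- strict.
  have hge : ∀ w : ℝ, (m : ℝ) + 1 ≤ w → 0 < gFun m w := by
    intro w hw
    have h1 : gFun m (w + 1) < gFun m w :=
      hanti hw (Set.mem_Ici.2 (by linarith)) (by linarith)
    have h2 : (0 : ℝ) ≤ gFun m (w + 1) := by
      refine le_of_tendsto hlim ?_
      filter_upwards [Filter.eventually_ge_atTop (w + 1)] with x hx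
      exact hanti.antitoneOn (Set.mem_Ici.2 (by linarith)) (Set.mem_Ici.2 (by linarith)) hx
    linarith
  have h0 : gFun m 0 < 0 := by
    rw [gFun_eq m le_rfl, zero_pow hm.ne']
    have := upperGamma_zero_pos m
    linarith
  have hm1 : (0 : ℝ) ≤ (m : ℝ) + 1 := by positivity
  obtain ⟨γ, hγ, hγ0⟩ := intermediate_value_Icc hm1
    ((continuousOn_gFun m).mono Set.Icc_subset_Ici_self) ⟨h0.le, (hge _ le_rfl).le⟩
  have hpos : 0 < γ := by
    refine lt_of_le_of_ne hγ.1 fun h => ?_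
    rw [← h] at hγ0
    exact h0.ne hγ0
  refine ⟨γ, hpos, hγ0, fun w hw hwγ => ?_, fun w hw => ?_⟩
  · rw [← hγ0]
    exact hmono ⟨hw, hwγ.le.trans hγ.2⟩ hγ hwγ
  · rcases le_total w (m + 1) with h | h
    · rw [← hγ0]
      exact hmono hγ ⟨hpos.le.trans hw.le, h⟩ hw
    · exact hge w h

/-! ### Geometry of the orthant. -/

theorem valuationSpace_eq_Ici (m : ℕ) : valuationSpace m = Set.Ici 0 := by
  ext x
  simp [valuationSpace, Pi.le_def]

theorem isClosed_valuationSpace (m : ℕ) : IsClosed (valuationSpace m) := by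
  rw [valuationSpace_eq_Ici]
  exact isClosed_Ici

theorem measurableSet_valuationSpace (m : ℕ) : MeasurableSet (valuationSpace m) :=
  (isClosed_valuationSpace m).measurableSet

theorem convex_valuationSpace (m : ℕ) : Convex ℝ (valuationSpace m) := by
  rw [valuationSpace_eq_Ici]
  exact convex_Ici 0

theorem interior_valuationSpace (m : ℕ) :
    interior (valuationSpace m) = {x | ∀ j, 0 < x j} := by
  have h : valuationSpace m = Set.univ.pi fun _ : Fin m => Set.Ici (0 : ℝ) := by
    ext x
    exact ⟨fun h j _ => h j, fun h j => h j trivial⟩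
  rw [h, interior_pi_set Set.finite_univ]
  ext x
  simp

theorem ae_mem_interior_valuationSpace (m : ℕ) :
    ∀ᵐ x ∂volume.restrict (valuationSpace m), x ∈ interior (valuationSpace m) := by
  rw [ae_restrict_iff' (measurableSet_valuationSpace m)]
  have := (convex_valuationSpace m).addHaar_frontier volume
  filter_upwards [measure_eq_zero_iff_ae_notMem.1 this] with x hx hxs
  by_contra h
  exact hx ⟨subset_closure hxs, h⟩

/-! ### The joint exponential law as a density. -/

/-- A product measure is determined by its values on boxes. On a box the indicator factors over the
coordinates, so the integral of the product density is a product of one-dimensional integrals. -/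
theorem iidExp_eq_withDensity_pi (m : ℕ) {l : ℝ} (hl : 0 < l) :
    iidExp m l = volume.withDensity
      fun x : Fin m → ℝ => ENNReal.ofReal (∏ j, exponentialPDFReal l (x j)) := by
  have hprob : IsProbabilityMeasure (expMeasure l) := isProbabilityMeasure_expMeasure hl
  have hnn : ∀ x, 0 ≤ exponentialPDFReal l x := exponentialPDFReal_nonneg hl
  have hint : Integrable (exponentialPDFReal l) := by
    refine ⟨(measurable_exponentialPDFReal l).aestronglyMeasurable, ?_⟩
    rw [hasFiniteIntegral_iff_ofReal (Filter.Eventually.of_forall hnn)]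
    have := lintegral_exponentialPDF_eq_one hl
    unfold exponentialPDF at this
    simp [this]
  refine Measure.pi_eq fun s hs => ?_
  rw [withDensity_apply _ (MeasurableSet.univ_pi hs), ← lintegral_indicator (MeasurableSet.univ_pi hs)]
  have hfun : ((Set.univ.pi s).indicator
      fun x : Fin m → ℝ => ENNReal.ofReal (∏ j, exponentialPDFReal l (x j))) =
      fun x => ENNReal.ofReal (∏ j, (s j).indicator (exponentialPDFReal l) (x j)) := by
    funext x
    by_cases hx : x ∈ Set.univ.pi s
    · rw [Set.indicator_of_mem hx]
      congr 1
      exact Finset.prod_congr rfl fun j _ => (Set.indicator_of_mem (hx j trivial) _).symm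
    · rw [Set.indicator_of_notMem hx]
      simp only [Set.mem_univ_pi, not_forall] at hx
      obtain ⟨j, hj⟩ := hx
      rw [Finset.prod_eq_zero (Finset.mem_univ j) (Set.indicator_of_notMem hj _),
        ENNReal.ofReal_zero]
  have hnn' : ∀ j x, 0 ≤ (s j).indicator (exponentialPDFReal l) x := fun j x =>
    Set.indicator_nonneg (fun x _ => hnn x) x
  have hint' : ∀ j, Integrable ((s j).indicator (exponentialPDFReal l)) := fun j =>
    hint.indicator (hs j)
  have hint'' : Integrable fun x : Fin m → ℝ => ∏ j, (s j).indicator (exponentialPDFReal l) (x j) :=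
    Integrable.fintype_prod_dep hint'
  rw [hfun, ← ofReal_integral_eq_lintegral_ofReal hint''
    (Filter.Eventually.of_forall fun x => Finset.prod_nonneg fun j _ => hnn' j _),
    integral_fintype_prod_volume_eq_prod,
    ENNReal.ofReal_prod_of_nonneg fun j _ => integral_nonneg (hnn' j)]
  refine Finset.prod_congr rfl fun j _ => ?_
  rw [ofReal_integral_eq_lintegral_ofReal (hint' j) (Filter.Eventually.of_forall (hnn' j)),
    expMeasure, gammaMeasure, withDensity_apply _ (hs j), ← lintegral_indicator (hs j)]
  refine lintegral_congr fun x => ?_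
  by_cases hx : x ∈ s j <;> simp [hx, gammaPDF, exponentialPDFReal]

/-- The joint density of i.i.d. exponential values. -/
noncomputable def expDensity (m : ℕ) (l : ℝ) (x : Fin m → ℝ) : ℝ :=
  l ^ m * Real.exp (-(l * ∑ j, x j))

theorem expDensity_pos (m : ℕ) {l : ℝ} (hl : 0 < l) (x : Fin m → ℝ) : 0 < expDensity m l x := by
  unfold expDensity
  positivity

theorem measurable_expDensity (m : ℕ) (l : ℝ) : Measurable (expDensity m l) := by
  unfold expDensity
  fun_prop

theorem iidExp_eq_withDensity (m : ℕ) {l : ℝ} (hl : 0 < l) :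
    iidExp m l = (volume.restrict (valuationSpace m)).withDensity
      fun x => ENNReal.ofReal (expDensity m l x) := by
  rw [iidExp_eq_withDensity_pi m hl, ← withDensity_indicator (measurableSet_valuationSpace m)]
  congr 1
  funext x
  by_cases hx : x ∈ valuationSpace m
  · rw [Set.indicator_of_mem hx]
    congr 1
    have : ∀ j, exponentialPDFReal l (x j) = l * Real.exp (-(l * x j)) := by
      intro j
      simp [exponentialPDFReal, gammaPDFReal, hx j]
    simp only [this, Finset.prod_mul_distrib, expDensity, ← Real.exp_sum, Finset.mul_sum,
      Finset.sum_neg_distrib]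
    simp
  · rw [Set.indicator_of_notMem hx]
    simp only [valuationSpace, Set.mem_ofPred_eq, not_forall] at hx
    obtain ⟨j, hj⟩ := hx
    rw [Finset.prod_eq_zero (Finset.mem_univ j), ENNReal.ofReal_zero]
    simp [exponentialPDFReal, gammaPDFReal, hj]

theorem iidExp_absolutelyContinuous (m : ℕ) {l : ℝ} (hl : 0 < l) :
    iidExp m l ≪ volume.restrict (valuationSpace m) := by
  rw [iidExp_eq_withDensity m hl]
  exact withDensity_absolutelyContinuous _ _

theorem isProbabilityMeasure_iidExp (m : ℕ) {l : ℝ} (hl : 0 < l) :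
    IsProbabilityMeasure (iidExp m l) := by
  have : IsProbabilityMeasure (expMeasure l) := isProbabilityMeasure_expMeasure hl
  unfold iidExp
  infer_instance

theorem integrable_id_expMeasure {l : ℝ} (hl : 0 < l) : Integrable (fun x => x) (expMeasure l) := by
  rw [expMeasure, gammaMeasure]
  have h : (gammaPDF 1 l) = fun x => ENNReal.ofReal (exponentialPDFReal l x) := rfl
  rw [h, integrable_withDensity_iff (measurable_exponentialPDFReal l).ennreal_ofReal
    (Filter.Eventually.of_forall fun _ => ENNReal.ofReal_lt_top)]
  have hi : IntegrableOn (fun x : ℝ => x ^ (1 : ℝ) * Real.exp (-l * x)) (Set.Ioi 0) := by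
    simpa using integrableOn_rpow_mul_exp_neg_mul_rpow (s := 1) (p := 1) (b := l)
      (by norm_num) one_pos hl
  rw [← integrable_indicator_iff measurableSet_Ioi] at hi
  refine (hi.const_mul l).congr (Filter.Eventually.of_forall fun x => ?_)
  simp only [ENNReal.toReal_ofReal (exponentialPDFReal_nonneg hl x)]
  rcases lt_trichotomy x 0 with hx | rfl | hx
  · simp [exponentialPDFReal, gammaPDFReal, hx.not_ge, hx.le]
  · simp
  · rw [Set.indicator_of_mem (Set.mem_Ioi.2 hx)]
    simp [exponentialPDFReal, gammaPDFReal, hx.le]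
    ring

theorem integrable_sum_iidExp (m : ℕ) {l : ℝ} (hl : 0 < l) :
    Integrable (fun x => ∑ j, x j) (iidExp m l) := by
  have : IsProbabilityMeasure (expMeasure l) := isProbabilityMeasure_expMeasure hl
  refine integrable_finsetSum _ fun j _ => ?_
  exact (measurePreserving_eval (fun _ : Fin m => expMeasure l) j).integrable_comp_of_integrable
    (integrable_id_expMeasure hl)

/-! ### Almost everywhere differentiability and measurability. -/

/-- Rademacher's theorem applies on a neighbourhood of each point, and a set that is locally null is
null. -/
theorem ae_differentiableAt_of_locallyLipschitzOn {E : Type*} [NormedAddCommGroup E]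
    [NormedSpace ℝ E] [FiniteDimensional ℝ E] [MeasurableSpace E] [BorelSpace E] (μ : Measure E)
    [μ.IsAddHaarMeasure] {f : E → ℝ} {U : Set E} (hU : IsOpen U) (hf : LocallyLipschitzOn U f) :
    ∀ᵐ x ∂μ, x ∈ U → DifferentiableAt ℝ f x := by
  have : ProperSpace E := FiniteDimensional.proper ℝ E
  refine measure_null_of_locally_null _ fun x hx => ?_
  simp only [Set.mem_compl_iff, Set.mem_ofPred_eq, Classical.not_imp] at hx
  obtain ⟨K, t, ht, hLip⟩ := hf hx.1
  rw [hU.nhdsWithin_eq hx.1] at ht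
  obtain ⟨V, hVt, hV, hxV⟩ := mem_nhds_iff.1 ht
  have hae := (hLip.mono hVt).ae_differentiableWithinAt_of_mem (μ := μ)
  refine ⟨V ∩ {y | ¬DifferentiableAt ℝ f y}, ?_, ?_⟩
  · refine Filter.inter_mem (mem_nhdsWithin_of_mem_nhds (hV.mem_nhds hxV)) ?_
    filter_upwards [self_mem_nhdsWithin] with y hy
    simp only [Set.mem_compl_iff, Set.mem_ofPred_eq, Classical.not_imp] at hy
    exact hy.2
  · refine measure_mono_null (fun y hy => ?_) hae
    simp only [Set.mem_compl_iff, Set.mem_ofPred_eq, Classical.not_imp]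
    exact ⟨hy.1, fun h => hy.2 (h.differentiableAt (hV.mem_nhds hy.1))⟩

theorem ConvexOn.ae_differentiableAt_valuationSpace {m : ℕ} {u : (Fin m → ℝ) → ℝ}
    (hu : ConvexOn ℝ (valuationSpace m) u) :
    ∀ᵐ x ∂volume.restrict (valuationSpace m), DifferentiableAt ℝ u x := by
  filter_upwards [ae_mem_interior_valuationSpace m, ae_restrict_of_ae
    (ae_differentiableAt_of_locallyLipschitzOn volume isOpen_interior
      hu.locallyLipschitzOn_interior)] with x hx h using h hx

theorem restrict_interior_valuationSpace (m : ℕ) :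
    volume.restrict (interior (valuationSpace m)) = volume.restrict (valuationSpace m) := by
  refine Measure.restrict_congr_set ?_
  have := (ae_restrict_iff' (measurableSet_valuationSpace m)).1 (ae_mem_interior_valuationSpace m)
  filter_upwards [this] with x hx
  exact propext ⟨fun h => interior_subset h, hx⟩

theorem ContinuousOn.aestronglyMeasurable_valuationSpace {m : ℕ} {u : (Fin m → ℝ) → ℝ}
    (hu : ContinuousOn u (interior (valuationSpace m))) :
    AEStronglyMeasurable u (volume.restrict (valuationSpace m)) := by
  rw [← restrict_interior_valuationSpace]
  exact hu.aestronglyMeasurable isOpen_interior.measurableSet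

/-! ### Radial derivatives and integration along rays. -/

/-- The derivative of `u` at `x` in the direction `x`. -/
noncomputable def radialD {m : ℕ} (u : (Fin m → ℝ) → ℝ) (x : Fin m → ℝ) : ℝ :=
  ∑ j, partialD u j x * x j

theorem fderiv_apply_eq_sum_partialD {m : ℕ} (u : (Fin m → ℝ) → ℝ) (x y : Fin m → ℝ) :
    fderiv ℝ u x y = ∑ j, partialD u j x * y j := by
  conv_lhs => rw [pi_eq_sum_univ' y, map_sum]
  refine Finset.sum_congr rfl fun j _ => ?_
  rw [map_smul, smul_eq_mul, mul_comm, partialD]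

theorem measurable_radialD {m : ℕ} (u : (Fin m → ℝ) → ℝ) : Measurable (radialD u) := by
  unfold radialD partialD
  refine Finset.measurable_sum _ fun j _ => ?_
  exact (measurable_fderiv_apply_const ℝ u _).mul (measurable_pi_apply j)

theorem radialD_mem_Icc {m : ℕ} {u : (Fin m → ℝ) → ℝ} {x : Fin m → ℝ} (hx : x ∈ valuationSpace m)
    (h : ∀ j, partialD u j x ∈ Set.Icc (0 : ℝ) 1) : radialD u x ∈ Set.Icc 0 (∑ j, x j) :=
  ⟨Finset.sum_nonneg fun j _ => mul_nonneg (h j).1 (hx j),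
    Finset.sum_le_sum fun j _ => mul_le_of_le_one_left (hx j) (h j).2⟩

theorem smul_mem_valuationSpace {m : ℕ} {x : Fin m → ℝ} (hx : x ∈ valuationSpace m) {t : ℝ}
    (ht : 0 ≤ t) : t • x ∈ valuationSpace m := fun j => mul_nonneg ht (hx j)

/-- A property that holds almost everywhere holds almost everywhere on almost every segment
from the origin. -/
theorem ae_ae_smul {m : ℕ} {P : (Fin m → ℝ) → Prop}
    (hP : ∀ᵐ x ∂volume.restrict (valuationSpace m), P x) :
    ∀ᵐ x ∂volume.restrict (valuationSpace m), ∀ᵐ t ∂volume.restrict (Set.Ioo (0 : ℝ) 1),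
      P (t • x) := by
  rw [ae_restrict_iff' (measurableSet_valuationSpace m)] at hP
  -- The exceptional set need not be measurable; its measurable hull is still null and allows the
  -- two almost-everywhere quantifiers to be exchanged. For fixed `t ≠ 0`, dilation pulls null sets
  -- back to null sets.
  set N := toMeasurable volume {x : Fin m → ℝ | ¬(x ∈ valuationSpace m → P x)} with hN
  have hN0 : volume N = 0 := by rw [hN, measure_toMeasurable]; exact hP
  have hNm : MeasurableSet N := measurableSet_toMeasurable _ _
  have hkey : ∀ᵐ x : Fin m → ℝ, ∀ᵐ t ∂volume.restrict (Set.Ioo (0 : ℝ) 1), t • x ∉ N := by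
    rw [Measure.ae_ae_comm]
    · filter_upwards [ae_restrict_mem measurableSet_Ioo] with t ht
      exact (Measure.quasiMeasurePreserving_smul volume ht.1.ne').ae
        (measure_eq_zero_iff_ae_notMem.1 hN0)
    · have hm : Measurable fun p : (Fin m → ℝ) × ℝ => p.2 • p.1 := by fun_prop
      exact (hm hNm).compl
  filter_upwards [ae_restrict_of_ae hkey, ae_restrict_mem (measurableSet_valuationSpace m)]
    with x hx hxs
  filter_upwards [hx, ae_restrict_mem measurableSet_Ioo] with t ht ht0
  by_contra h
  exact ht (subset_toMeasurable _ _ fun h' => h (h' (smul_mem_valuationSpace hxs ht0.1.le)))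

/-- A convex function is the integral of its almost everywhere defined derivative. -/
theorem ConvexOn.integral_deriv_eq_sub {v d : ℝ → ℝ} {S : Set ℝ} {a b : ℝ} (hab : a ≤ b)
    (hv : ConvexOn ℝ S v) (hS : Set.Icc a b ⊆ interior S)
    (hd : ∀ᵐ t ∂volume.restrict (Set.Ioc a b), HasDerivAt v (d t) t) :
    IntegrableOn d (Set.Ioc a b) ∧ ∫ t in Set.Ioc a b, d t = v b - v a := by
  -- The right derivative of a convex function exists at every interior point and is monotone, hence
  -- integrable, so the one-sided fundamental theorem applies; it equals `d` wherever `v` has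
  -- derivative `d t`.
  have hmono : MonotoneOn (fun t => derivWithin v (Set.Ioi t) t) (Set.uIcc a b) := by
    rw [Set.uIcc_of_le hab]
    exact hv.monotoneOn_rightDeriv.mono hS
  have hint := hmono.intervalIntegrable (μ := volume)
  have hftc := intervalIntegral.integral_eq_sub_of_hasDeriv_right_of_le hab
    (hv.continuousOn_interior.mono hS)
    (fun t ht => hv.hasDerivWithinAt_rightDeriv_of_mem_interior (hS (Set.Ioo_subset_Icc_self ht)))
    hint
  have heq : (fun t => derivWithin v (Set.Ioi t) t) =ᵐ[volume.restrict (Set.Ioc a b)] d := by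
    filter_upwards [hd] with t ht
    exact ht.hasDerivWithinAt.derivWithin (uniqueDiffWithinAt_Ioi t)
  rw [intervalIntegrable_iff_integrableOn_Ioc_of_le hab] at hint
  rw [intervalIntegral.integral_of_le hab] at hftc
  exact ⟨hint.congr heq, by rw [← hftc, integral_congr_ae heq]⟩

theorem ConvexOn.comp_smul_ray {m : ℕ} {u : (Fin m → ℝ) → ℝ}
    (hu : ConvexOn ℝ (valuationSpace m) u) {x : Fin m → ℝ} (hx : x ∈ valuationSpace m) :
    ConvexOn ℝ (Set.Ici (0 : ℝ)) fun t => u (t • x) := by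
  have h := hu.comp_linearMap (LinearMap.toSpanSingleton ℝ (Fin m → ℝ) x)
  exact h.subset (fun t ht => smul_mem_valuationSpace hx ht) (convex_Ici 0)

theorem hasDerivAt_comp_smul {m : ℕ} {u : (Fin m → ℝ) → ℝ} {x : Fin m → ℝ} {t : ℝ} (ht : t ≠ 0)
    (h : DifferentiableAt ℝ u (t • x)) :
    HasDerivAt (fun r : ℝ => u (r • x)) (radialD u (t • x) / t) t := by
  have h1 : HasDerivAt (fun r : ℝ => r • x) x t := by
    simpa using (hasDerivAt_id t).smul_const x
  refine (h.hasFDerivAt.comp_hasDerivAt t h1).congr_deriv ?_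
  rw [fderiv_apply_eq_sum_partialD, radialD, Finset.sum_div]
  refine Finset.sum_congr rfl fun j _ => ?_
  simp only [Pi.smul_apply, smul_eq_mul]
  field_simp

/-- The integral of the radial derivative along the segment from the origin to `x`. -/
noncomputable def radialIntegral {m : ℕ} (D : (Fin m → ℝ) → ℝ) (x : Fin m → ℝ) : ENNReal :=
  ∫⁻ t in Set.Ioo (0 : ℝ) 1, ENNReal.ofReal (D (t • x) / t)

/-- A convex function on the closed orthant may jump at the origin, so the derivative is integrated
only over `[ε, 1]`. The lower bound on `u x` then uses only `u (ε • x) ≥ 0`; the upper bound uses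
convexity instead of continuity at `0`. -/
theorem radialIntegral_le_and_le {m : ℕ} {u : (Fin m → ℝ) → ℝ} (hu : IsFeasibleUtility u) :
    ∀ᵐ x ∂volume.restrict (valuationSpace m),
      radialIntegral (radialD u) x ≤ ENNReal.ofReal (u x) ∧ u x ≤ u 0 + ∑ j, x j := by
  obtain ⟨hconv, hnn, hpart⟩ := hu
  filter_upwards [ae_ae_smul (hpart.and hconv.ae_differentiableAt_valuationSpace),
    ae_restrict_mem (measurableSet_valuationSpace m)] with x hx hxs
  have hs : 0 ≤ ∑ j, x j := Finset.sum_nonneg fun j _ => hxs j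
  have hv := hconv.comp_smul_ray hxs
  have hbd : ∀ᵐ t ∂volume.restrict (Set.Ioc (0 : ℝ) 1),
      HasDerivAt (fun r : ℝ => u (r • x)) (radialD u (t • x) / t) t ∧
        radialD u (t • x) / t ∈ Set.Icc 0 (∑ j, x j) := by
    rw [← restrict_Ioo_eq_restrict_Ioc]
    filter_upwards [hx, ae_restrict_mem measurableSet_Ioo] with t ht ht0
    refine ⟨hasDerivAt_comp_smul ht0.1.ne' ht.2, ?_⟩
    have := radialD_mem_Icc (smul_mem_valuationSpace hxs ht0.1.le) ht.1
    refine ⟨div_nonneg this.1 ht0.1.le, ?_⟩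
    rw [div_le_iff₀ ht0.1, mul_comm, Finset.mul_sum]
    exact this.2
  have hseg : ∀ ε : ℝ, 0 < ε → ε ≤ 1 →
      IntegrableOn (fun t => radialD u (t • x) / t) (Set.Ioc ε 1) ∧
        ∫ t in Set.Ioc ε 1, radialD u (t • x) / t = u x - u (ε • x) := by
    intro ε hε hε1
    have hsub : Set.Icc ε 1 ⊆ interior (Set.Ici (0 : ℝ)) := by
      rw [interior_Ici]
      exact fun t ht => hε.trans_le ht.1
    have := hv.integral_deriv_eq_sub hε1 hsub
      ((ae_restrict_of_ae_restrict_of_subset (Set.Ioc_subset_Ioc_left hε.le) hbd).mono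
        fun t ht => ht.1)
    simpa using this
  constructor
  · refine ENNReal.le_of_forall_pos_le_add fun δ hδ _ => ?_
    -- The integrand is at most `∑ j, x j`, so the piece over `(0, ε]` contributes at most `δ`. The
    -- `1 +` in the witness guards against a zero sum.
    obtain ⟨ε, hε, hε1, hεδ⟩ : ∃ ε : ℝ, 0 < ε ∧ ε ≤ 1 ∧ ε * ∑ j, x j ≤ δ := by
      refine ⟨min 1 (δ / (1 + ∑ j, x j)), by positivity, min_le_left _ _, ?_⟩
      calc min 1 (δ / (1 + ∑ j, x j)) * ∑ j, x j
          ≤ δ / (1 + ∑ j, x j) * (1 + ∑ j, x j) := by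
            gcongr
            · exact min_le_right _ _
            · linarith
        _ = δ := by field_simp
    obtain ⟨hi, hval⟩ := hseg ε hε hε1
    rw [radialIntegral, restrict_Ioo_eq_restrict_Ioc, ← Set.Ioc_union_Ioc_eq_Ioc hε.le hε1, add_comm]
    refine (lintegral_union_le _ _ _).trans (add_le_add ?_ ?_)
    · calc ∫⁻ t in Set.Ioc 0 ε, ENNReal.ofReal (radialD u (t • x) / t)
          ≤ ∫⁻ _ in Set.Ioc 0 ε, ENNReal.ofReal (∑ j, x j) := by
            refine lintegral_mono_ae ?_
            filter_upwards [ae_restrict_of_ae_restrict_of_subset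
              (Set.Ioc_subset_Ioc_right hε1) hbd] with t ht
            exact ENNReal.ofReal_le_ofReal ht.2.2
        _ = ENNReal.ofReal (ε * ∑ j, x j) := by
            simp [ENNReal.ofReal_mul hε.le, mul_comm]
        _ ≤ δ := ENNReal.ofReal_le_of_le_toReal (by simpa using hεδ)
    · rw [← ofReal_integral_eq_lintegral_ofReal hi, hval]
      · exact ENNReal.ofReal_le_ofReal
          (sub_le_self _ (hnn _ (smul_mem_valuationSpace hxs hε.le)))
      · filter_upwards [ae_restrict_of_ae_restrict_of_subset
          (Set.Ioc_subset_Ioc_left hε.le) hbd] with t ht using ht.2.1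
  -- With `s` the sum, `u x - u (x/2) ≤ s/2` and midpoint convexity `u (x/2) ≤ (u 0 + u x)/2` add up
  -- to the claim.
  · obtain ⟨hi, hval⟩ := hseg (1 / 2) (by norm_num) (by norm_num)
    have hle : ∫ t in Set.Ioc (1 / 2 : ℝ) 1, radialD u (t • x) / t ≤
        ∫ _ in Set.Ioc (1 / 2 : ℝ) 1, ∑ j, x j := by
      refine integral_mono_ae hi (integrable_const _) ?_
      filter_upwards [ae_restrict_of_ae_restrict_of_subset
        (Set.Ioc_subset_Ioc_left (by norm_num)) hbd] with t ht using ht.2.2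
    have hc := hv.2 (Set.mem_Ici.2 le_rfl) (Set.mem_Ici.2 zero_le_one)
      (show (0 : ℝ) ≤ 1 / 2 by norm_num) (show (0 : ℝ) ≤ 1 / 2 by norm_num) (by norm_num)
    simp only [integral_const, smul_eq_mul, measureReal_restrict_apply_univ,
      Real.volume_real_Ioc] at hle
    norm_num at hle hc hval
    linarith

/-! ### Exchanging the radial and spatial integrals. -/

/-- The substitution `r = w / t` maps `(0, 1)` onto `(w, ∞)`. -/
theorem lintegral_Ioo_exp_neg_div (m : ℕ) (hm : 0 < m) {w : ℝ} (hw : 0 < w) :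
    ∫⁻ t in Set.Ioo (0 : ℝ) 1, ENNReal.ofReal ((t⁻¹) ^ (m + 1) * Real.exp (-(w / t))) =
      ENNReal.ofReal (upperGamma m w / w ^ m) := by
  have himg : (fun t => w / t) '' Set.Ioo (0 : ℝ) 1 = Set.Ioi w := by
    ext y
    constructor
    · rintro ⟨t, ht, rfl⟩
      exact (lt_div_iff₀ ht.1).2 (by nlinarith [ht.2])
    · intro hy
      have hy0 : 0 < y := hw.trans hy
      exact ⟨w / y, ⟨div_pos hw hy0, (div_lt_one hy0).2 hy⟩, by field_simp⟩
  have hinj : Set.InjOn (fun t => w / t) (Set.Ioo (0 : ℝ) 1) := by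
    intro a ha b hb hab
    have := ha.1.ne'
    have := hb.1.ne'
    simp only at hab
    field_simp at hab
    exact hab.symm
  have h := lintegral_image_eq_lintegral_abs_deriv_mul (f' := fun t => -w / t ^ 2)
    measurableSet_Ioo
    (fun t ht => by
      have := ((hasDerivAt_inv ht.1.ne').const_mul w).hasDerivWithinAt (s := Set.Ioo (0 : ℝ) 1)
      simp only [← div_eq_mul_inv] at this
      refine this.congr_deriv ?_
      ring) hinj
    (fun t => ENNReal.ofReal (t ^ (m - 1) * Real.exp (-t)))
  rw [himg, ← ofReal_integral_eq_lintegral_ofReal (integrableOn_pow_mul_exp_neg _ w hw.le)] at h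
  · change ENNReal.ofReal (upperGamma m w) = _ at h
    rw [div_eq_inv_mul, ENNReal.ofReal_mul (by positivity), h,
      ← lintegral_const_mul' _ _ ENNReal.ofReal_ne_top]
    refine setLIntegral_congr_fun measurableSet_Ioo fun t ht => ?_
    have ht0 := ht.1
    rw [← ENNReal.ofReal_mul (abs_nonneg _), ← ENNReal.ofReal_mul (by positivity)]
    congr 1
    rw [neg_div, abs_neg, abs_of_pos (by positivity)]
    obtain ⟨k, rfl⟩ := Nat.exists_eq_succ_of_ne_zero hm.ne'
    simp only [Nat.succ_eq_add_one, Nat.add_sub_cancel, inv_pow, div_pow]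
    field_simp
    ring
  · filter_upwards [ae_restrict_mem measurableSet_Ioi] with t ht
    have : 0 < t := hw.trans ht
    positivity

theorem lintegral_comp_smul_valuationSpace {m : ℕ} {h : (Fin m → ℝ) → ENNReal}
    (hh : Measurable h) {t : ℝ} (ht : 0 < t) :
    ∫⁻ x in valuationSpace m, h (t • x) =
      ENNReal.ofReal ((t⁻¹) ^ m) * ∫⁻ y in valuationSpace m, h y := by
  have hV := measurableSet_valuationSpace m
  rw [← lintegral_indicator hV, ← lintegral_indicator hV]
  have hmap := Measure.map_addHaar_smul (volume : Measure (Fin m → ℝ)) ht.ne'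
  have := lintegral_map (μ := volume) (hh.indicator hV) (measurable_const_smul t)
  rw [hmap, lintegral_smul_measure, Module.finrank_fin_fun, abs_of_pos (by positivity),
    smul_eq_mul, ← inv_pow] at this
  rw [this]
  refine lintegral_congr fun x => ?_
  have hiff : t • x ∈ valuationSpace m ↔ x ∈ valuationSpace m :=
    forall_congr' fun j => by simp [ht]
  by_cases hx : x ∈ valuationSpace m
  · simp [Set.indicator_of_mem hx, Set.indicator_of_mem (hiff.2 hx)]
  · simp [Set.indicator_of_notMem hx, Set.indicator_of_notMem (hx ∘ hiff.1)]

theorem sum_pos_of_mem_interior {m : ℕ} (hm : 0 < m) {x : Fin m → ℝ}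
    (hx : x ∈ interior (valuationSpace m)) : 0 < ∑ j, x j := by
  rw [interior_valuationSpace] at hx
  exact Finset.sum_pos (fun j _ => hx j) ⟨⟨0, hm⟩, Finset.mem_univ _⟩

/-- The density obtained by spreading the exponential density along segments to the origin. -/
noncomputable def radialWeight (m : ℕ) (l : ℝ) (y : Fin m → ℝ) : ℝ :=
  l ^ m * (upperGamma m (l * ∑ j, y j) / (l * ∑ j, y j) ^ m)

/-- Tonelli is used twice. For fixed `t` the substitution `y = t x` has Jacobian `t⁻¹ ^ m`, which
with the `1 / t` of the radial integral gives `t⁻¹ ^ (m + 1)`; for fixed `y` the remaining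
`t`-integral is an incomplete Gamma function. -/
theorem lintegral_radialIntegral {m : ℕ} (hm : 0 < m) {l : ℝ} (hl : 0 < l)
    {D : (Fin m → ℝ) → ℝ} (hD : Measurable D) :
    ∫⁻ x, radialIntegral D x ∂iidExp m l =
      ∫⁻ y in valuationSpace m, ENNReal.ofReal (D y) * ENNReal.ofReal (radialWeight m l y) := by
  have hρ := measurable_expDensity m l
  have hJm : Measurable (radialIntegral D) := by
    unfold radialIntegral
    refine Measurable.lintegral_prod_right'
      (f := fun p : (Fin m → ℝ) × ℝ => ENNReal.ofReal (D (p.2 • p.1) / p.2)) ?_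
    exact ((hD.comp (by fun_prop)).div measurable_snd).ennreal_ofReal
  rw [iidExp_eq_withDensity m hl,
    lintegral_withDensity_eq_lintegral_mul _ hρ.ennreal_ofReal hJm]
  have h1 : ∀ x, ((fun x => ENNReal.ofReal (expDensity m l x)) * radialIntegral D) x =
      ∫⁻ t in Set.Ioo (0 : ℝ) 1,
        ENNReal.ofReal (expDensity m l x) * ENNReal.ofReal (D (t • x) / t) := fun x => by
    rw [lintegral_const_mul' _ _ ENNReal.ofReal_ne_top]
    rfl
  simp only [h1]
  rw [lintegral_lintegral_swap]
  swap
  · exact ((hρ.comp measurable_fst).ennreal_ofReal.mul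
      ((hD.comp (by fun_prop)).div measurable_snd).ennreal_ofReal).aemeasurable
  have h2 : ∀ t ∈ Set.Ioo (0 : ℝ) 1,
      ∫⁻ x in valuationSpace m,
        ENNReal.ofReal (expDensity m l x) * ENNReal.ofReal (D (t • x) / t) =
      ∫⁻ y in valuationSpace m, ENNReal.ofReal (D y) *
        ENNReal.ofReal ((t⁻¹) ^ (m + 1) * expDensity m l (t⁻¹ • y)) := by
    intro t ht
    have hc := lintegral_comp_smul_valuationSpace (m := m) (t := t)
      (h := fun y => ENNReal.ofReal (expDensity m l (t⁻¹ • y)) * ENNReal.ofReal (D y / t))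
      ((hρ.comp (measurable_const_smul t⁻¹)).ennreal_ofReal.mul (hD.div_const t).ennreal_ofReal)
      ht.1
    simp only [inv_smul_smul₀ ht.1.ne'] at hc
    rw [hc, ← lintegral_const_mul' _ _ ENNReal.ofReal_ne_top]
    refine lintegral_congr fun y => ?_
    have h0 := (expDensity_pos m hl (t⁻¹ • y)).le
    have ht0 := inv_pos.2 ht.1
    rw [div_eq_mul_inv, ENNReal.ofReal_mul' ht0.le, pow_succ, mul_assoc,
      ENNReal.ofReal_mul (by positivity), ENNReal.ofReal_mul (by positivity)]
    ring
  rw [setLIntegral_congr_fun measurableSet_Ioo h2, lintegral_lintegral_swap]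
  swap
  · refine Measurable.aemeasurable ?_
    refine ((hD.comp measurable_snd).ennreal_ofReal.mul
      (Measurable.ennreal_ofReal ((measurable_fst.inv.pow_const _).mul (hρ.comp ?_))))
    fun_prop
  refine lintegral_congr_ae ?_
  filter_upwards [ae_mem_interior_valuationSpace m] with y hy
  have hs := sum_pos_of_mem_interior hm hy
  have hls : 0 < l * ∑ j, y j := mul_pos hl hs
  rw [lintegral_const_mul' _ _ ENNReal.ofReal_ne_top, radialWeight,
    ENNReal.ofReal_mul (by positivity), ← lintegral_Ioo_exp_neg_div m hm hls,
    ← lintegral_const_mul' (ENNReal.ofReal (l ^ m)) _ ENNReal.ofReal_ne_top]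
  congr 1
  refine setLIntegral_congr_fun measurableSet_Ioo fun t ht => ?_
  rw [← ENNReal.ofReal_mul (by positivity)]
  congr 1
  simp only [expDensity, Pi.smul_apply, smul_eq_mul, ← Finset.mul_sum]
  rw [show l * (t⁻¹ * ∑ j, y j) = l * (∑ j, y j) / t by ring]
  ring

/-- The density against which the radial derivative is integrated in the revenue functional. -/
noncomputable def virtualWeight (m : ℕ) (l : ℝ) (y : Fin m → ℝ) : ℝ :=
  l ^ m * (gFun m (l * ∑ j, y j) / (l * ∑ j, y j) ^ m)

theorem virtualWeight_eq {m : ℕ} (hm : 0 < m) {l : ℝ} (hl : 0 < l) {y : Fin m → ℝ}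
    (hy : y ∈ interior (valuationSpace m)) :
    virtualWeight m l y = expDensity m l y - radialWeight m l y := by
  have hls : 0 < l * ∑ j, y j := mul_pos hl (sum_pos_of_mem_interior hm hy)
  rw [virtualWeight, gFun_eq m hls.le, expDensity, radialWeight]
  field_simp

theorem radialWeight_nonneg {m : ℕ} {l : ℝ} (hl : 0 < l) {y : Fin m → ℝ}
    (hy : y ∈ valuationSpace m) : 0 ≤ radialWeight m l y := by
  have hs : 0 ≤ ∑ j, y j := Finset.sum_nonneg fun j _ => hy j
  have := upperGamma_nonneg m (mul_nonneg hl.le hs)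
  unfold radialWeight
  positivity

theorem aestronglyMeasurable_radialWeight {m : ℕ} (hm : 0 < m) {l : ℝ} (hl : 0 < l) :
    AEStronglyMeasurable (radialWeight m l) (volume.restrict (valuationSpace m)) := by
  refine ContinuousOn.aestronglyMeasurable_valuationSpace ?_
  have hpos : ∀ y ∈ interior (valuationSpace m), 0 < l * ∑ j, y j := fun y hy =>
    mul_pos hl (sum_pos_of_mem_interior hm hy)
  have hlin : Continuous fun y : Fin m → ℝ => l * ∑ j, y j := by fun_prop
  refine continuousOn_const.mul (ContinuousOn.div ?_ (hlin.pow m).continuousOn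
    fun y hy => pow_ne_zero _ (hpos y hy).ne')
  exact (continuousOn_upperGamma m).comp hlin.continuousOn fun y hy => (hpos y hy).le

/-- If `u` is recovered from `D` by integration along segments to the origin, then the revenue
`∫ (D - u) dF` is the integral of `D` against the virtual weight. -/
theorem integral_sub_radialIntegral {m : ℕ} (hm : 0 < m) {l : ℝ} (hl : 0 < l)
    {D : (Fin m → ℝ) → ℝ} (hD : Measurable D)
    (hD0 : ∀ᵐ x ∂volume.restrict (valuationSpace m), 0 ≤ D x)
    (hDi : Integrable D (iidExp m l)) (hJ : ∫⁻ x, radialIntegral D x ∂iidExp m l ≠ ⊤) :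
    IntegrableOn (fun y => D y * virtualWeight m l y) (valuationSpace m) ∧
      ∫ y in valuationSpace m, D y * virtualWeight m l y =
        ∫ x, D x ∂iidExp m l - (∫⁻ x, radialIntegral D x ∂iidExp m l).toReal := by
  have hρ : Measurable fun x => ENNReal.ofReal (expDensity m l x) :=
    (measurable_expDensity m l).ennreal_ofReal
  have hfin : ∀ᵐ x ∂volume.restrict (valuationSpace m), ENNReal.ofReal (expDensity m l x) < ⊤ :=
    Filter.Eventually.of_forall fun _ => ENNReal.ofReal_lt_top
  have hto : ∀ x, (ENNReal.ofReal (expDensity m l x)).toReal = expDensity m l x := fun x =>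
    ENNReal.toReal_ofReal (expDensity_pos m hl x).le
  have hi1 : IntegrableOn (fun y => D y * expDensity m l y) (valuationSpace m) := by
    rw [iidExp_eq_withDensity m hl, integrable_withDensity_iff hρ hfin] at hDi
    simp only [hto] at hDi
    exact hDi
  have hv1 : ∫ x, D x ∂iidExp m l = ∫ y in valuationSpace m, D y * expDensity m l y := by
    rw [iidExp_eq_withDensity m hl, integral_withDensity_eq_integral_toReal_smul hρ hfin]
    simp only [hto, smul_eq_mul, mul_comm]
  have hnn : ∀ᵐ y ∂volume.restrict (valuationSpace m), 0 ≤ D y * radialWeight m l y := by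
    filter_upwards [hD0, ae_restrict_mem (measurableSet_valuationSpace m)] with y h1 h2
    exact mul_nonneg h1 (radialWeight_nonneg hl h2)
  have hmeas : AEStronglyMeasurable (fun y => D y * radialWeight m l y)
      (volume.restrict (valuationSpace m)) :=
    hD.aestronglyMeasurable.mul (aestronglyMeasurable_radialWeight hm hl)
  have hJe : ∫⁻ x, radialIntegral D x ∂iidExp m l =
      ∫⁻ y in valuationSpace m, ENNReal.ofReal (D y * radialWeight m l y) := by
    rw [lintegral_radialIntegral hm hl hD]
    refine lintegral_congr_ae ?_
    filter_upwards [hD0] with y hy using (ENNReal.ofReal_mul hy).symm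
  have hi2 : IntegrableOn (fun y => D y * radialWeight m l y) (valuationSpace m) := by
    refine ⟨hmeas, ?_⟩
    rw [hasFiniteIntegral_iff_ofReal hnn, ← hJe]
    exact hJ.lt_top
  have heq : (fun y => D y * expDensity m l y - D y * radialWeight m l y)
      =ᵐ[volume.restrict (valuationSpace m)] fun y => D y * virtualWeight m l y := by
    filter_upwards [ae_mem_interior_valuationSpace m] with y hy
    rw [virtualWeight_eq hm hl hy]
    ring
  refine ⟨(hi1.sub hi2).congr heq, ?_⟩
  rw [← integral_congr_ae heq, integral_sub hi1 hi2, hv1, hJe,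
    integral_eq_lintegral_of_nonneg_ae hnn hmeas]

/-! ### Integrability and the revenue bound for feasible utilities. -/

theorem IsFeasibleUtility.integrable {m : ℕ} {l : ℝ} (hl : 0 < l) {u : (Fin m → ℝ) → ℝ}
    (hu : IsFeasibleUtility u) : Integrable u (iidExp m l) := by
  have := isProbabilityMeasure_iidExp m hl
  have hac := iidExp_absolutelyContinuous m hl
  refine ((integrable_const (u 0)).add (integrable_sum_iidExp m hl)).mono'
    (hu.1.continuousOn_interior.aestronglyMeasurable_valuationSpace.mono_ac hac) ?_
  filter_upwards [hac.ae_le (radialIntegral_le_and_le hu),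
    hac.ae_le (ae_restrict_mem (measurableSet_valuationSpace m))] with x hx hxs
  rw [Real.norm_of_nonneg (hu.2.1 x hxs)]
  exact hx.2

theorem IsFeasibleUtility.radialD_mem {m : ℕ} {u : (Fin m → ℝ) → ℝ} (hu : IsFeasibleUtility u) :
    ∀ᵐ x ∂volume.restrict (valuationSpace m), radialD u x ∈ Set.Icc 0 (∑ j, x j) := by
  filter_upwards [hu.2.2, ae_restrict_mem (measurableSet_valuationSpace m)] with x hx hxs
  exact radialD_mem_Icc hxs hx

theorem IsFeasibleUtility.integrable_radialD {m : ℕ} {l : ℝ} (hl : 0 < l)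
    {u : (Fin m → ℝ) → ℝ} (hu : IsFeasibleUtility u) : Integrable (radialD u) (iidExp m l) := by
  refine (integrable_sum_iidExp m hl).mono' (measurable_radialD u).aestronglyMeasurable ?_
  filter_upwards [(iidExp_absolutelyContinuous m hl).ae_le hu.radialD_mem] with x hx
  rw [Real.norm_of_nonneg hx.1]
  exact hx.2

/-- Replacing `u` by the smaller radial integral can only raise the revenue; what is lost is the
limit of `u` at the origin along rays. -/
theorem IsFeasibleUtility.utilityRevenue_le {m : ℕ} (hm : 0 < m) {l : ℝ} (hl : 0 < l)
    {u : (Fin m → ℝ) → ℝ} (hu : IsFeasibleUtility u) :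
    IntegrableOn (fun y => radialD u y * virtualWeight m l y) (valuationSpace m) ∧
      utilityRevenue u (iidExp m l) ≤
        ∫ y in valuationSpace m, radialD u y * virtualWeight m l y := by
  have hac := iidExp_absolutelyContinuous m hl
  have hui := hu.integrable hl
  have hDi := hu.integrable_radialD hl
  have hu0 : 0 ≤ᵐ[iidExp m l] u := by
    filter_upwards [hac.ae_le (ae_restrict_mem (measurableSet_valuationSpace m))] with x hx
    exact hu.2.1 x hx
  have hle : ∫⁻ x, radialIntegral (radialD u) x ∂iidExp m l ≤
      ∫⁻ x, ENNReal.ofReal (u x) ∂iidExp m l := by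
    refine lintegral_mono_ae ?_
    filter_upwards [hac.ae_le (radialIntegral_le_and_le hu)] with x hx using hx.1
  have hfin : ∫⁻ x, ENNReal.ofReal (u x) ∂iidExp m l ≠ ⊤ :=
    ((hasFiniteIntegral_iff_ofReal hu0).1 hui.2).ne
  obtain ⟨h1, h2⟩ := integral_sub_radialIntegral hm hl (measurable_radialD u)
    (hu.radialD_mem.mono fun x hx => hx.1) hDi (ne_top_of_le_ne_top hfin hle)
  refine ⟨h1, ?_⟩
  have hrev : utilityRevenue u (iidExp m l) = ∫ x, (radialD u x - u x) ∂iidExp m l := rfl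
  rw [h2, hrev, integral_sub hDi hui, integral_eq_lintegral_of_nonneg_ae hu0 hui.1]
  exact sub_le_sub_left (ENNReal.toReal_mono hfin hle) _

/-! ### From mechanisms to utilities. -/

namespace Mechanism

/-- Envelope argument: by truthfulness, the truthful utility minus the affine utility of always
reporting `x` is nonnegative and vanishes at `x`, so its derivative there is zero. -/
theorem IsFeasible.partialD_utility {m : ℕ} {M : Mechanism m} (hM : M.IsFeasible)
    {x : Fin m → ℝ} (hx : x ∈ interior (valuationSpace m))
    (hd : DifferentiableAt ℝ (fun y => M.utility y y) x) (j : Fin m) :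
    partialD (fun y => M.utility y y) j x = M.alloc x j := by
  have hmin : IsLocalMin (fun y => M.utility y y - M.utility x y) x := by
    filter_upwards [isOpen_interior.mem_nhds hx] with y hy
    simpa using hM.2.2 y (interior_subset hy) x (interior_subset hx)
  have hlin : HasFDerivAt (fun y : Fin m → ℝ => M.utility x y)
      (∑ i, M.alloc x i • (ContinuousLinearMap.proj i : (Fin m → ℝ) →L[ℝ] ℝ)) x := by
    unfold Mechanism.utility
    refine HasFDerivAt.sub_const _ (HasFDerivAt.fun_sum fun i _ => ?_)
    exact (hasFDerivAt_apply i x).const_mul (M.alloc x i)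
  have h := hmin.hasFDerivAt_eq_zero (hd.hasFDerivAt.sub hlin)
  rw [partialD, sub_eq_zero.1 h]
  simp [Pi.single_apply]

/-- Truthful utility is a pointwise maximum of functions affine in the true values, hence convex. -/
theorem IsFeasible.isFeasibleUtility {m : ℕ} {M : Mechanism m} (hM : M.IsFeasible) :
    IsFeasibleUtility fun x => M.utility x x := by
  refine ⟨⟨convex_valuationSpace m, fun x hx y hy a b ha hb hab => ?_⟩, hM.2.1, ?_⟩
  · have hz : a • x + b • y ∈ valuationSpace m := convex_valuationSpace m hx hy ha hb hab
    have h1 := mul_le_mul_of_nonneg_left (hM.2.2 x hx _ hz) ha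
    have h2 := mul_le_mul_of_nonneg_left (hM.2.2 y hy _ hz) hb
    refine le_trans (le_of_eq ?_) (add_le_add h1 h2)
    have hpay : M.pay (a • x + b • y) =
        a * M.pay (a • x + b • y) + b * M.pay (a • x + b • y) := by
      rw [← add_mul, hab, one_mul]
    have hsum : ∑ j, M.alloc (a • x + b • y) j * (a • x + b • y) j =
        a * ∑ j, M.alloc (a • x + b • y) j * x j + b * ∑ j, M.alloc (a • x + b • y) j * y j := by
      rw [Finset.mul_sum, Finset.mul_sum, ← Finset.sum_add_distrib]
      refine Finset.sum_congr rfl fun j _ => ?_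
      simp only [Pi.add_apply, Pi.smul_apply, smul_eq_mul]
      ring
    simp only [utility]
    linarith
  · filter_upwards [ae_mem_interior_valuationSpace m] with x hx j
    by_cases hd : DifferentiableAt ℝ (fun y => M.utility y y) x
    · rw [hM.partialD_utility hx hd]
      exact (hM.1 x (interior_subset hx)).1 j
    -- Without differentiability `fderiv` takes the default value `0`, which lies in `[0, 1]`.
    · simp [partialD, fderiv_zero_of_not_differentiableAt hd]

theorem IsFeasible.pay_ae_eq {m : ℕ} {M : Mechanism m} (hM : M.IsFeasible) :
    M.pay =ᵐ[volume.restrict (valuationSpace m)]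
      fun x => radialD (fun y => M.utility y y) x - M.utility x x := by
  filter_upwards [ae_mem_interior_valuationSpace m,
    hM.isFeasibleUtility.1.ae_differentiableAt_valuationSpace] with x hx hd
  simp only [radialD, hM.partialD_utility hx hd]
  simp only [utility]
  ring

theorem IsFeasible.integrable_pay {m : ℕ} {l : ℝ} (hl : 0 < l) {M : Mechanism m}
    (hM : M.IsFeasible) : Integrable M.pay (iidExp m l) :=
  ((hM.isFeasibleUtility.integrable_radialD hl).sub (hM.isFeasibleUtility.integrable hl)).congr
    (Filter.EventuallyEq.symm ((iidExp_absolutelyContinuous m hl).ae_le hM.pay_ae_eq))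

theorem IsFeasible.revenue_eq_utilityRevenue {m : ℕ} {l : ℝ} (hl : 0 < l) {M : Mechanism m}
    (hM : M.IsFeasible) :
    M.revenue (iidExp m l) = utilityRevenue (fun x => M.utility x x) (iidExp m l) :=
  integral_congr_ae ((iidExp_absolutelyContinuous m hl).ae_le hM.pay_ae_eq)

theorem fullBundle_utility {m : ℕ} (q : ℝ) (x' x : Fin m → ℝ) :
    (fullBundle m q).utility x' x = if q ≤ ∑ j, x' j then ∑ j, x j - q else 0 := by
  by_cases h : q ≤ ∑ j, x' j <;> simp [utility, fullBundle, h]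

theorem fullBundle_isFeasible {m : ℕ} {q : ℝ} (hq : 0 ≤ q) : (fullBundle m q).IsFeasible := by
  refine ⟨fun x _ => ⟨fun j => ?_, ?_⟩, fun x _ => ?_, fun x _ x' _ => ?_⟩
  · by_cases h : q ≤ ∑ j, x j <;> simp [fullBundle, h]
  · by_cases h : q ≤ ∑ j, x j <;> simp [fullBundle, h, hq]
  · rw [fullBundle_utility]
    split_ifs with h
    exacts [sub_nonneg.2 h, le_rfl]
  · rw [fullBundle_utility, fullBundle_utility]
    split_ifs <;> linarith

end Mechanism

/-! ### The revenue of full bundling. -/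

open Classical in
/-- The radial derivative of the utility under full bundling at price `q`. -/
noncomputable def bundleD (m : ℕ) (q : ℝ) (x : Fin m → ℝ) : ℝ :=
  if q ≤ ∑ j, x j then ∑ j, x j else 0

theorem measurable_bundleD (m : ℕ) (q : ℝ) : Measurable (bundleD m q) := by
  unfold bundleD
  exact Measurable.ite (measurableSet_le measurable_const (by fun_prop)) (by fun_prop)
    measurable_const

theorem bundleD_mem_Icc {m : ℕ} (q : ℝ) {x : Fin m → ℝ} (hx : x ∈ valuationSpace m) :
    bundleD m q x ∈ Set.Icc 0 (∑ j, x j) := by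
  have hs : 0 ≤ ∑ j, x j := Finset.sum_nonneg fun j _ => hx j
  unfold bundleD
  split_ifs
  exacts [⟨hs, le_rfl⟩, ⟨le_rfl, hs⟩]

/-- With `s` the sum, the integrand is `s` for `t ≥ q / s` and `0` before, so the integral is the
positive part of `s - q`. -/
theorem radialIntegral_bundleD {m : ℕ} {q : ℝ} (hq : 0 ≤ q) {x : Fin m → ℝ} (hx : 0 < ∑ j, x j) :
    radialIntegral (bundleD m q) x =
      ENNReal.ofReal ((Mechanism.fullBundle m q).utility x x) := by
  rw [Mechanism.fullBundle_utility, radialIntegral]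
  set s := ∑ j, x j with hs
  have hfun : ∀ t ∈ Set.Ioo (0 : ℝ) 1, ENNReal.ofReal (bundleD m q (t • x) / t) =
      (Set.Ici (q / s)).indicator (fun _ => ENNReal.ofReal s) t := by
    intro t ht
    have hsum : ∑ j, (t • x) j = t * s := by simp [hs, Finset.mul_sum]
    have hiff : q ≤ t * s ↔ t ∈ Set.Ici (q / s) := by rw [Set.mem_Ici, div_le_iff₀ hx]
    by_cases h : q ≤ t * s
    · rw [Set.indicator_of_mem (hiff.1 h), bundleD, hsum, if_pos h,
        mul_div_cancel_left₀ _ ht.1.ne']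
    · rw [Set.indicator_of_notMem (mt hiff.2 h), bundleD, hsum, if_neg h, zero_div,
        ENNReal.ofReal_zero]
  have hmax : max (q / s) 0 = q / s := max_eq_left (div_nonneg hq hx.le)
  rw [setLIntegral_congr_fun measurableSet_Ioo hfun, restrict_Ioo_eq_restrict_Icc,
    lintegral_indicator_const measurableSet_Ici, Measure.restrict_apply measurableSet_Ici,
    ← Set.Ici_inter_Iic, ← Set.inter_assoc, Set.Ici_inter_Ici, hmax, Set.Ici_inter_Iic,
    Real.volume_Icc, ← ENNReal.ofReal_mul hx.le, mul_sub, mul_div_cancel₀ _ hx.ne', mul_one]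
  split_ifs with h
  · rfl
  · rw [ENNReal.ofReal_zero, ENNReal.ofReal_eq_zero]
    linarith

/-- The bundling utility is recovered exactly from its radial derivative, so the general revenue
bound becomes an equality. -/
theorem revenue_fullBundle {m : ℕ} (hm : 0 < m) {l : ℝ} (hl : 0 < l) {q : ℝ} (hq : 0 ≤ q) :
    IntegrableOn (fun y => bundleD m q y * virtualWeight m l y) (valuationSpace m) ∧
      (Mechanism.fullBundle m q).revenue (iidExp m l) =
        ∫ y in valuationSpace m, bundleD m q y * virtualWeight m l y := by
  have hac := iidExp_absolutelyContinuous m hl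
  have hM := Mechanism.fullBundle_isFeasible (m := m) hq
  have hui := hM.isFeasibleUtility.integrable hl
  have hDi : Integrable (bundleD m q) (iidExp m l) := by
    refine (integrable_sum_iidExp m hl).mono' (measurable_bundleD m q).aestronglyMeasurable ?_
    filter_upwards [hac.ae_le (ae_restrict_mem (measurableSet_valuationSpace m))] with x hx
    rw [Real.norm_of_nonneg (bundleD_mem_Icc q hx).1]
    exact (bundleD_mem_Icc q hx).2
  have hu0 : 0 ≤ᵐ[iidExp m l] fun x => (Mechanism.fullBundle m q).utility x x := by
    filter_upwards [hac.ae_le (ae_restrict_mem (measurableSet_valuationSpace m))] with x hx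
    exact hM.2.1 x hx
  have hJ : ∫⁻ x, radialIntegral (bundleD m q) x ∂iidExp m l =
      ∫⁻ x, ENNReal.ofReal ((Mechanism.fullBundle m q).utility x x) ∂iidExp m l := by
    refine lintegral_congr_ae ?_
    filter_upwards [hac.ae_le (ae_mem_interior_valuationSpace m)] with x hx
    exact radialIntegral_bundleD hq (sum_pos_of_mem_interior hm hx)
  have hfin := ((hasFiniteIntegral_iff_ofReal hu0).1 hui.2).ne
  obtain ⟨h1, h2⟩ := integral_sub_radialIntegral hm hl (measurable_bundleD m q)
    ((ae_restrict_mem (measurableSet_valuationSpace m)).mono fun x hx =>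
      (bundleD_mem_Icc q hx).1) hDi (hJ ▸ hfin)
  refine ⟨h1, ?_⟩
  rw [h2, hJ, ← integral_eq_lintegral_of_nonneg_ae hu0 hui.1, ← integral_sub hDi hui]
  refine integral_congr_ae (Filter.Eventually.of_forall fun x => ?_)
  simp only [Mechanism.fullBundle_utility, bundleD]
  simp only [Mechanism.fullBundle]
  split_ifs <;> simp

/-! ### Pointwise optimization and uniqueness of the price. -/

/-- A linear function of `d` on an interval is maximal at the endpoint selected by the sign of the
weight, and that sign switches exactly at the price `γ / l`. -/
theorem mul_virtualWeight_le {m : ℕ} (hm : 0 < m) {l : ℝ} (hl : 0 < l) {γ : ℝ}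
    (hneg : ∀ w, 0 ≤ w → w < γ → gFun m w < 0) (h0 : gFun m γ = 0)
    (hpos : ∀ w, γ < w → 0 < gFun m w) {y : Fin m → ℝ}
    (hy : y ∈ interior (valuationSpace m)) {d : ℝ} (hd : d ∈ Set.Icc 0 (∑ j, y j)) :
    d * virtualWeight m l y ≤ bundleD m (γ / l) y * virtualWeight m l y := by
  have hls : 0 < l * ∑ j, y j := mul_pos hl (sum_pos_of_mem_interior hm hy)
  unfold bundleD virtualWeight
  split_ifs with h
  · rw [div_le_iff₀' hl] at h
    have hg : 0 ≤ gFun m (l * ∑ j, y j) := by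
      rcases h.eq_or_lt with h | h
      · rw [← h, h0]
      · exact (hpos _ h).le
    exact mul_le_mul_of_nonneg_right hd.2 (by positivity)
  · rw [not_le, lt_div_iff₀' hl] at h
    rw [zero_mul]
    refine mul_nonpos_of_nonneg_of_nonpos hd.1 (mul_nonpos_of_nonneg_of_nonpos (by positivity) ?_)
    exact div_nonpos_of_nonpos_of_nonneg (hneg _ hls.le h).le (by positivity)

theorem volume_sum_mem_Ioo_pos {m : ℕ} (hm : 0 < m) {a b : ℝ} (ha : 0 ≤ a) (hab : a < b) :
    0 < volume (interior (valuationSpace m) ∩ {x | ∑ j, x j ∈ Set.Ioo a b}) := by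
  have hcont : Continuous fun x : Fin m → ℝ => ∑ j, x j := by fun_prop
  refine (isOpen_interior.inter (isOpen_Ioo.preimage hcont)).measure_pos _
    -- The constant vector whose coordinates sum to the midpoint of `(a, b)`.
    ⟨fun _ => (a + b) / 2 / m, ?_, ?_⟩
  · rw [interior_valuationSpace]
    intro j
    have : 0 < a + b := by linarith
    positivity
  · have : (m : ℝ) ≠ 0 := by positivity
    simp only [Set.mem_preimage, Finset.sum_const, Finset.card_univ, Fintype.card_fin,
      nsmul_eq_mul, mul_div_cancel₀ _ this]
    constructor <;> linarith

/-- The two integrands are ordered almost everywhere and differ where the sum lies strictly between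
the prices: there exactly one mechanism sells and `g` is nonzero. This slab has positive volume. -/
theorem revenue_fullBundle_lt {m : ℕ} (hm : 0 < m) {l : ℝ} (hl : 0 < l) {γ : ℝ} (hγ : 0 < γ)
    (hneg : ∀ w, 0 ≤ w → w < γ → gFun m w < 0) (h0 : gFun m γ = 0)
    (hpos : ∀ w, γ < w → 0 < gFun m w) {q : ℝ} (hq : 0 ≤ q) (hne : q ≠ γ / l) :
    (Mechanism.fullBundle m q).revenue (iidExp m l) <
      (Mechanism.fullBundle m (γ / l)).revenue (iidExp m l) := by
  have hγl : 0 < γ / l := div_pos hγ hl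
  obtain ⟨hi1, hr1⟩ := revenue_fullBundle hm hl hq
  obtain ⟨hi2, hr2⟩ := revenue_fullBundle hm hl hγl.le
  rw [hr1, hr2, ← sub_pos, ← integral_sub hi2 hi1, integral_pos_iff_support_of_nonneg_ae]
  · have hVm := isOpen_interior.measurableSet (s := interior (valuationSpace m))
    rw [← restrict_interior_valuationSpace, Measure.restrict_apply' hVm,
      Set.inter_comm]
    refine lt_of_lt_of_le (volume_sum_mem_Ioo_pos hm (le_min hq hγl.le) (min_lt_max.2 hne))
      (measure_mono (Set.inter_subset_inter_right _ fun y hy => ?_))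
    have hls : 0 < l * ∑ j, y j := mul_pos hl ((le_min hq hγl.le).trans_lt hy.1)
    have hκ : gFun m (l * ∑ j, y j) ≠ 0 → virtualWeight m l y ≠ 0 := fun h =>
      mul_ne_zero (by positivity) (div_ne_zero h (by positivity))
    simp only [Function.mem_support, ← sub_mul, bundleD]
    rcases hne.lt_or_gt with h | h
    · rw [min_eq_left h.le, max_eq_right h.le] at hy
      rw [if_neg hy.2.not_ge, if_pos hy.1.le, zero_sub]
      exact mul_ne_zero (neg_ne_zero.2 (hq.trans_lt hy.1).ne')
        (hκ (hneg _ hls.le ((lt_div_iff₀' hl).1 hy.2)).ne)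
    · rw [min_eq_right h.le, max_eq_left h.le] at hy
      rw [if_neg hy.2.not_ge, if_pos hy.1.le, sub_zero]
      exact mul_ne_zero (hγl.trans hy.1).ne' (hκ (hpos _ ((div_lt_iff₀' hl).1 hy.1)).ne')
  · filter_upwards [ae_mem_interior_valuationSpace m] with y hy
    exact sub_nonneg.2 (mul_virtualWeight_le hm hl hneg h0 hpos hy
      (bundleD_mem_Icc q (interior_subset hy)))
  · exact hi2.sub hi1

theorem utilityRevenue_le_fullBundle {m : ℕ} (hm : 0 < m) {l : ℝ} (hl : 0 < l) {γ : ℝ}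
    (hγ : 0 < γ) (hneg : ∀ w, 0 ≤ w → w < γ → gFun m w < 0) (h0 : gFun m γ = 0)
    (hpos : ∀ w, γ < w → 0 < gFun m w) {u : (Fin m → ℝ) → ℝ} (hu : IsFeasibleUtility u) :
    utilityRevenue u (iidExp m l) ≤
      (Mechanism.fullBundle m (γ / l)).revenue (iidExp m l) := by
  obtain ⟨hi1, hr1⟩ := hu.utilityRevenue_le hm hl
  obtain ⟨hi2, hr2⟩ := revenue_fullBundle hm hl (div_pos hγ hl).le
  rw [hr2]
  refine hr1.trans (integral_mono_ae hi1 hi2 ?_)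
  filter_upwards [ae_mem_interior_valuationSpace m, hu.radialD_mem] with y hy hd
  exact mul_virtualWeight_le hm hl hneg h0 hpos hy hd

theorem mainTheorem1 (m : ℕ) (hm : 0 < m) (l : ℝ) (hl : 0 < l) :
    ∃ γ : ℝ,
      -- `γ` is the unique root of `g(m, ·)` on `[0, ∞)`, and it is positive
      (0 < γ ∧ gFun m γ = 0 ∧ ∀ w : ℝ, 0 ≤ w → gFun m w = 0 → w = γ) ∧
      -- expected revenues are well defined
      (∀ M : Mechanism m, M.IsFeasible → Integrable M.pay (iidExp m l)) ∧
      -- full bundling at the price `γ / l` is an optimal mechanism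
      (Mechanism.fullBundle m (γ / l)).IsOptimal (iidExp m l) ∧
      -- no other bundle price is optimal
      (∀ q : ℝ, 0 ≤ q → (Mechanism.fullBundle m q).IsOptimal (iidExp m l) → q = γ / l) ∧
      -- its revenue is the maximum of `R(u; F)` over all feasible utility functions `u`
      IsGreatest {r : ℝ | ∃ u : (Fin m → ℝ) → ℝ,
          IsFeasibleUtility u ∧ r = utilityRevenue u (iidExp m l)}
        ((Mechanism.fullBundle m (γ / l)).revenue (iidExp m l)) := by
  obtain ⟨γ, hγ, h0, hneg, hpos⟩ := exists_gFun_sign hm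
  have hfeas := Mechanism.fullBundle_isFeasible (m := m) (div_pos hγ hl).le
  refine ⟨γ, ⟨hγ, h0, fun w hw hw0 => ?_⟩, fun M hM => hM.integrable_pay hl,
    ⟨hfeas, fun M hM => ?_⟩, fun q hq hopt => ?_,
    ⟨_, hfeas.isFeasibleUtility, hfeas.revenue_eq_utilityRevenue hl⟩, ?_⟩
  · rcases lt_trichotomy w γ with h | h | h
    · exact absurd hw0 (hneg w hw h).ne
    · exact h
    · exact absurd hw0 (hpos w h).ne'
  · rw [hM.revenue_eq_utilityRevenue hl]
    exact utilityRevenue_le_fullBundle hm hl hγ hneg h0 hpos hM.isFeasibleUtility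
  · by_contra hne
    exact (revenue_fullBundle_lt hm hl hγ hneg h0 hpos hq hne).not_ge (hopt.2 _ hfeas)
  · rintro r ⟨u, hu, rfl⟩
    exact utilityRevenue_le_fullBundle hm hl hγ hneg h0 hpos hu
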